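/- A $c$-partite tournament is a digraph obtained by orienting each edge of a complete $c$-partite graph with parts $V_1,\dots,V_c$; it is balanced if all parts have the same number $r$ of vertices. For a vertex $x$ let $d^+(x)$, $d^-(x)$ be its out- and in-degree, and let $d_i^+(x)$, $d_i^-(x)$ be the numbers of its out- and in-neighbours in $V_i$. For a finite nonempty digraph $D$ put $$\delta(D)=\min_{x\in V(D)}\min\{d^+(x),d^-(x)\},\qquad i_g(D)=\max_{x,y\in V(D)}\bigl(\max\{d^+(x),d^-(x)\}-\min\{d^+(y),d^-(y)\}\bigr),$$ and for a $c$-partite tournament $G$ put $$\mu(G)=\max_{x\in V(G)}\max_{1\le i\le c}|d_i^+(x)-d_i^-(x)|.$$ Theorem. Let $G$ be a finite balanced $c$-partite tournament with parts of size $r\ge 2$, such that $$\delta(G)\ \ge\ \Bigl\lfloor\frac{c-2}{4}\Bigr\rfloor\,\bigl(r+\mu(G)\bigr)\,\frac{c-1}{c-2}.$$ Suppose that at least one of the following holds: (i) $i_g(G)\le r/2$, $c\ge 13$ and $c\notin\{14,15,18\}$; (ii) $i_g(G)\le r$, $c\ge 17$ and $c\notin\{18,19,22\}$; (iii) $i_g(G)\le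 3r/2$, $c\ge 21$ and $c\notin\{22,23,26\}$. Then $G$ contains a subdigraph $T$ on $c$ vertices that is a strongly connected tournament with $\delta(T)\ge\lfloor (c-2)/4\rfloor+1$. -/

import Mathlib

namespace PartiteTournament

/-- The out-degree `d⁺(x)`. -/
noncomputable def outDeg {V : Type*} (D : Digraph V) (x : V) : ℕ :=
  {y : V | D.Adj x y}.ncard

/-- The in-degree `d⁻(x)`. -/
noncomputable def inDeg {V : Type*} (D : Digraph V) (x : V) : ℕ :=
  {y : V | D.Adj y x}.ncard

/-- `d⁺ᵢ(x)`: the number of out-neighbours of `x` in the part `Vᵢ = {y | part y = i}`. -/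
noncomputable def outDegIn {V : Type*} {c : ℕ} (D : Digraph V) (part : V → Fin c)
    (i : Fin c) (x : V) : ℕ :=
  {y : V | part y = i ∧ D.Adj x y}.ncard

/-- `d⁻ᵢ(x)`: the number of in-neighbours of `x` in the part `Vᵢ = {y | part y = i}`. -/
noncomputable def inDegIn {V : Type*} {c : ℕ} (D : Digraph V) (part : V → Fin c)
    (i : Fin c) (x : V) : ℕ :=
  {y : V | part y = i ∧ D.Adj y x}.ncard

/-- The minimum degree `δ(D)`: the least of all in- and out-degrees
(a minimum, as `D` is finite and nonempty wherever this is used). -/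
noncomputable def minDeg {V : Type*} (D : Digraph V) : ℕ :=
  ⨅ x : V, min (outDeg D x) (inDeg D x)

/-- The global irregularity
`i_g(D) = max_{x,y} (max {d⁺(x), d⁻(x)} - min {d⁺(y), d⁻(y)})`. -/
noncomputable def globalIrreg {V : Type*} (D : Digraph V) : ℤ :=
  ⨆ p : V × V,
    ((max (outDeg D p.1) (inDeg D p.1) : ℕ) : ℤ) - ((min (outDeg D p.2) (inDeg D p.2) : ℕ) : ℤ)

/-- The local partite irregularity `μ(D) = max_x max_i |d⁺ᵢ(x) - d⁻ᵢ(x)|`. -/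
noncomputable def localIrreg {V : Type*} {c : ℕ} (D : Digraph V) (part : V → Fin c) : ℤ :=
  ⨆ p : V × Fin c, |(outDegIn D part p.2 p.1 : ℤ) - (inDegIn D part p.2 p.1 : ℤ)|

/-- `D` is an orientation of the complete `c`-partite graph whose parts are the fibres of `part`,
and every part has exactly `r` vertices. -/
structure IsBalancedPartiteTournament {V : Type*} (D : Digraph V) (r c : ℕ)
    (part : V → Fin c) : Prop where
  not_adj_of_same_part : ∀ x y, part x = part y → ¬ D.Adj x y
  xor_adj : ∀ x y, part x ≠ part y → Xor (D.Adj x y) (D.Adj y x)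
  card_part : ∀ i : Fin c, {x : V | part x = i}.ncard = r

/-- The subdigraph of `D` induced by a set of vertices. -/
def induced {V : Type*} (D : Digraph V) (S : Set V) : Digraph S where
  Adj x y := D.Adj x y

/-- A tournament: no loops, and exactly one arc between any two distinct vertices. -/
structure IsTournament {V : Type*} (D : Digraph V) : Prop where
  loopless : ∀ x, ¬ D.Adj x x
  xor_adj : ∀ x y, x ≠ y → Xor (D.Adj x y) (D.Adj y x)

/-- Strong connectivity: there is a directed walk from every vertex to every vertex. -/
def IsStrong {V : Type*} (D : Digraph V) : Prop :=
  ∀ x y : V, Relation.ReflTransGen D.Adj x y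

end PartiteTournament

namespace PartiteTournament

open Polynomial

/-! Pick one vertex from each part uniformly at random. Any transversal induces a tournament on `c`
vertices, so only its degrees matter. Given that `x` is picked, its out-degree in the transversal is
a sum of `c - 1` independent Bernoulli variables with parameters `d⁺ⱼ(x) / r`, and likewise for its
in-degree. Since `d⁺(x) + d⁻(x) = r(c - 1)`, an irregularity of at most `jr/2` makes the mean at
least `(c - 1)/2 - j/4`. Hoeffding's comparison (`lowerTail_le_const`) and monotonicity
(`lowerTail_anti`) bound the chance of a degree at most `⌊(c - 2)/4⌋` by a binomial tail with
parameter `1/2 - j/(4(c - 1))`. If `2c` times this tail is below 1, a union bound over vertices and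
directions gives a transversal with all degrees large (`exists_transversal`). The numerical
inequality is checked exactly for small `c` and by an exponential moment for large `c`. Strong
connectivity then comes for free from the minimum degree (`IsTournament.isStrong`). -/

/-- The generating polynomial of a sum of independent Bernoulli variables with parameters `p i`,
`i ∈ s`. -/
noncomputable def bernoulliGen {ι : Type*} (s : Finset ι) (p : ι → ℝ) : ℝ[X] :=
  ∏ i ∈ s, (C (1 - p i) + C (p i) * X)

/-- The probability that a sum of independent Bernoulli variables is less than `k`. -/
noncomputable def lowerTail {ι : Type*} (s : Finset ι) (p : ι → ℝ) (k : ℕ) : ℝ :=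
  ∑ l ∈ Finset.range k, (bernoulliGen s p).coeff l

/-! ### Lower tails of sums of independent Bernoulli variables. -/

section PoissonBinomial

variable {ι : Type*} [DecidableEq ι]

lemma coeff_bernoulliGen_insert {s : Finset ι} {p : ι → ℝ} {i : ι} (hi : i ∉ s) (k : ℕ) :
    (bernoulliGen (insert i s) p).coeff k =
      (1 - p i) * (bernoulliGen s p).coeff k + p i * (X * bernoulliGen s p).coeff k := by
  rw [bernoulliGen, Finset.prod_insert hi, ← bernoulliGen, add_mul, mul_assoc, coeff_add,
    coeff_C_mul, coeff_C_mul]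

lemma coeff_bernoulliGen_nonneg {s : Finset ι} {p : ι → ℝ}
    (hp : ∀ i ∈ s, 0 ≤ p i ∧ p i ≤ 1) (k : ℕ) : 0 ≤ (bernoulliGen s p).coeff k := by
  induction s using Finset.induction_on generalizing k with
  | empty =>
    simp only [bernoulliGen, Finset.prod_empty, coeff_one]
    split_ifs <;> norm_num
  | insert i s hi ih =>
    have h1 := hp i (Finset.mem_insert_self i s)
    have h2 := ih fun j hj => hp j (Finset.mem_insert_of_mem hj)
    rw [coeff_bernoulliGen_insert hi]
    refine add_nonneg (mul_nonneg (by linarith) (h2 k)) (mul_nonneg h1.1 ?_)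
    cases k with
    | zero => simp
    | succ k => rw [coeff_X_mul]; exact h2 k

lemma lowerTail_insert_succ {s : Finset ι} {p : ι → ℝ} {i : ι} (hi : i ∉ s) (k : ℕ) :
    lowerTail (insert i s) p (k + 1) =
      lowerTail s p (k + 1) - p i * (bernoulliGen s p).coeff k := by
  induction k with
  | zero => simp [lowerTail, coeff_bernoulliGen_insert hi]; ring
  | succ k ih =>
    rw [lowerTail, Finset.sum_range_succ, ← lowerTail, ih, coeff_bernoulliGen_insert hi,
      coeff_X_mul, lowerTail, lowerTail, Finset.sum_range_succ _ (k + 1)]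
    ring

/-- Compare coefficients in the derivative of the product. -/
lemma succ_mul_coeff_bernoulliGen (s : Finset ι) (p : ι → ℝ) (k : ℕ) :
    ((k : ℝ) + 1) * (bernoulliGen s p).coeff (k + 1) =
      ∑ i ∈ s, p i * (bernoulliGen (s.erase i) p).coeff k := by
  have h := coeff_derivative (bernoulliGen s p) k
  rw [mul_comm, ← h, bernoulliGen, derivative_prod_finset, finsetSum_coeff]
  refine Finset.sum_congr rfl fun i _ => ?_
  simp [bernoulliGen, mul_comm _ (C (p i))]

/-- Left of its mean, the distribution of a sum of independent Bernoulli variables increases. -/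
lemma coeff_X_mul_bernoulliGen_le {s : Finset ι} {p : ι → ℝ}
    (hp : ∀ i ∈ s, 0 ≤ p i ∧ p i ≤ 1) {k : ℕ} (hk : (k : ℝ) ≤ ∑ i ∈ s, p i) :
    (X * bernoulliGen s p).coeff k ≤ (bernoulliGen s p).coeff k := by
  induction k generalizing s with
  | zero => simpa using coeff_bernoulliGen_nonneg hp 0
  | succ k ih =>
    rw [coeff_X_mul]
    push_cast at hk
    have key : (∑ i ∈ s, p i) * (bernoulliGen s p).coeff k ≤
        ((k : ℝ) + 1) * (bernoulliGen s p).coeff (k + 1) := by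
      rw [succ_mul_coeff_bernoulliGen, Finset.sum_mul]
      refine Finset.sum_le_sum fun i hi => ?_
      obtain ⟨h0, h1⟩ := hp i hi
      have hsum := Finset.add_sum_erase s p hi
      have hrec := ih (s := s.erase i) (fun j hj => hp j (Finset.mem_of_mem_erase hj))
        (by linarith)
      have hins := coeff_bernoulliGen_insert (p := p) (Finset.notMem_erase i s) k
      rw [Finset.insert_erase hi] at hins
      rw [hins]
      -- Restoring the factor `i` averages the coefficients at `k` and `k - 1` of the product
      -- without it; by `hrec` the latter is no larger.
      nlinarith [mul_le_mul_of_nonneg_left hrec (mul_nonneg h0 h0)]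
    have h0 := coeff_bernoulliGen_nonneg hp k
    have h2 : ((k : ℝ) + 1) * (bernoulliGen s p).coeff k ≤
        (∑ i ∈ s, p i) * (bernoulliGen s p).coeff k := mul_le_mul_of_nonneg_right hk h0
    exact le_of_mul_le_mul_left (h2.trans key) (by positivity)

/-- Moving two parameters towards each other increases the lower tail left of the mean. -/
lemma lowerTail_le_of_mul_le {s : Finset ι} {p p' : ι → ℝ} {i j : ι} {k : ℕ} (hi : i ∈ s)
    (hj : j ∈ s) (hij : i ≠ j) (hp : ∀ i ∈ s, 0 ≤ p i ∧ p i ≤ 1)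
    (hk : (k : ℝ) + 2 ≤ ∑ i ∈ s, p i) (hsum : p' i + p' j = p i + p j)
    (hmul : p i * p j ≤ p' i * p' j) (hother : ∀ l ∈ s, l ≠ i → l ≠ j → p' l = p l) :
    lowerTail s p (k + 1) ≤ lowerTail s p' (k + 1) := by
  set t := (s.erase i).erase j with ht
  have hjs : j ∈ s.erase i := Finset.mem_erase.2 ⟨hij.symm, hj⟩
  have hjt : j ∉ t := Finset.notMem_erase _ _
  have hit : i ∉ insert j t := by
    rw [ht, Finset.insert_erase hjs]; exact Finset.notMem_erase _ _
  have hs : insert i (insert j t) = s := by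
    rw [ht, Finset.insert_erase hjs, Finset.insert_erase hi]
  have hts : ∀ l ∈ t, l ∈ s := fun l hl => Finset.mem_of_mem_erase (Finset.mem_of_mem_erase hl)
  have hgen : bernoulliGen t p' = bernoulliGen t p := by
    refine Finset.prod_congr rfl fun l hl => ?_
    rw [hother l (hts l hl) (fun h => hit (h ▸ Finset.mem_insert_of_mem hl))
      (fun h => hjt (h ▸ hl))]
  have hmean : (k : ℝ) ≤ ∑ l ∈ t, p l := by
    have h1 := Finset.add_sum_erase s p hi
    have h2 := Finset.add_sum_erase _ p hjs
    linarith [(hp i hi).2, (hp j hj).2]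
  have hmode := coeff_X_mul_bernoulliGen_le (fun l hl => hp l (hts l hl)) hmean
  -- The tail depends on the two parameters only through their sum and product. The product's
  -- coefficient is nonnegative by `hmode`; dropping two parameters from the mean costs the `+ 2` in
  -- `hk`.
  have expand : ∀ q : ι → ℝ, lowerTail s q (k + 1) = lowerTail t q (k + 1)
      - (q i + q j) * (bernoulliGen t q).coeff k
      + q i * q j * ((bernoulliGen t q).coeff k - (X * bernoulliGen t q).coeff k) := by
    intro q
    rw [← hs, lowerTail_insert_succ hit, lowerTail_insert_succ hjt,
      coeff_bernoulliGen_insert hjt]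
    ring
  rw [expand p, expand p', hsum]
  simp only [lowerTail, hgen]
  have := mul_le_mul_of_nonneg_right hmul (sub_nonneg.2 hmode)
  linarith

/-- Hoeffding's comparison: among sums of independent Bernoulli variables with given mean, the
lower tail below the mean is largest for equal parameters. -/
lemma lowerTail_le_const {s : Finset ι} {p : ι → ℝ} {q : ℝ} {k : ℕ}
    (hp : ∀ i ∈ s, 0 ≤ p i ∧ p i ≤ 1) (hk : (k : ℝ) + 2 ≤ ∑ i ∈ s, p i)
    (hq : ∑ i ∈ s, p i = s.card * q) :
    lowerTail s p (k + 1) ≤ lowerTail s (fun _ => q) (k + 1) := by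
  induction hN : (s.filter fun i => p i ≠ q).card using Nat.strong_induction_on generalizing p with
  | _ N ih =>
  by_cases hall : ∀ i ∈ s, p i = q
  · refine le_of_eq ?_
    have : bernoulliGen s p = bernoulliGen s fun _ => q :=
      Finset.prod_congr rfl fun i hi => by rw [hall i hi]
    simp only [lowerTail, this]
  · push Not at hall
    obtain ⟨l, hl, hlq⟩ := hall
    have hzero : ∑ i ∈ s, (p i - q) = 0 := by
      rw [Finset.sum_sub_distrib, hq]; simp
    have hzero' : ∑ i ∈ s, (q - p i) = 0 := by
      rw [Finset.sum_sub_distrib, hq]; simp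
    obtain ⟨j, hj, hjq⟩ := Finset.exists_pos_of_sum_zero_of_exists_nonzero _ hzero
      ⟨l, hl, sub_ne_zero.2 hlq⟩
    obtain ⟨i, hi, hiq⟩ := Finset.exists_pos_of_sum_zero_of_exists_nonzero _ hzero'
      ⟨l, hl, sub_ne_zero.2 hlq.symm⟩
    have hij : i ≠ j := by rintro rfl; linarith
    -- Here `p i < q < p j`. Moving `p i` to `q` at the expense of `p j` raises the product by `(q -
    -- p i)(p j - q)` and leaves fewer parameters different from `q`.
    set p' : ι → ℝ := Function.update (Function.update p i q) j (p i + p j - q) with hp'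
    have hpi : p' i = q := by simp [hp', hij]
    have hpj : p' j = p i + p j - q := by simp [hp']
    have hother : ∀ l, l ≠ i → l ≠ j → p' l = p l := by
      intro l h1 h2; simp [hp', h1, h2]
    have hstep : lowerTail s p (k + 1) ≤ lowerTail s p' (k + 1) := by
      refine lowerTail_le_of_mul_le hi hj hij hp hk (by rw [hpi, hpj]; ring) ?_
        fun l _ => hother l
      rw [hpi, hpj]
      nlinarith [mul_pos hiq hjq]
    have hsum : ∑ i ∈ s, p' i = ∑ i ∈ s, p i := by
      have hjs : j ∈ s.erase i := Finset.mem_erase.2 ⟨hij.symm, hj⟩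
      rw [← Finset.add_sum_erase s p hi, ← Finset.add_sum_erase s p' hi,
        ← Finset.add_sum_erase _ p hjs, ← Finset.add_sum_erase _ p' hjs, hpi, hpj,
        Finset.sum_congr rfl fun l hl => hother l
          (Finset.ne_of_mem_erase (Finset.mem_of_mem_erase hl)) (Finset.ne_of_mem_erase hl)]
      ring
    refine hstep.trans (ih _ ?_ (p := p') ?_ (hsum ▸ hk) (hsum ▸ hq) rfl)
    · rw [← hN]
      refine Finset.card_lt_card (Finset.ssubset_iff_of_subset ?_ |>.2
        ⟨i, Finset.mem_filter.2 ⟨hi, by linarith⟩, by simp [hpi]⟩)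
      intro l hl
      obtain ⟨hl, hlq⟩ := Finset.mem_filter.1 hl
      refine Finset.mem_filter.2 ⟨hl, ?_⟩
      by_cases h1 : l = i
      · subst h1; exact absurd hpi hlq
      by_cases h2 : l = j
      · subst h2; linarith
      rwa [hother l h1 h2] at hlq
    · intro l hl
      by_cases h1 : l = i
      · subst h1; rw [hpi]; constructor <;> linarith [hp l hl, hp j hj]
      by_cases h2 : l = j
      · subst h2; rw [hpj]; constructor <;> linarith [hp l hl, hp i hi]
      rw [hother l h1 h2]; exact hp l hl

/-- The lower tail decreases in the parameters. -/
lemma lowerTail_anti {s : Finset ι} {p p' : ι → ℝ} (hp : ∀ i ∈ s, 0 ≤ p i)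
    (hpp : ∀ i ∈ s, p i ≤ p' i) (hp' : ∀ i ∈ s, p' i ≤ 1) (k : ℕ) :
    lowerTail s p' k ≤ lowerTail s p k := by
  induction s using Finset.induction_on generalizing k with
  | empty => simp [lowerTail, bernoulliGen]
  | insert i s hi ih =>
    cases k with
    | zero => simp [lowerTail]
    | succ k =>
      have hm : ∀ j ∈ s, j ∈ insert i s := fun j => Finset.mem_insert_of_mem
      have hii := Finset.mem_insert_self i s
      have ih' := ih (fun j hj => hp j (hm j hj)) (fun j hj => hpp j (hm j hj))
        (fun j hj => hp' j (hm j hj))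
      have h1 := ih' k
      have h2 := ih' (k + 1)
      have h3 := coeff_bernoulliGen_nonneg (s := s) (p := p')
        (fun j hj => ⟨(hp j (hm j hj)).trans (hpp j (hm j hj)), hp' j (hm j hj)⟩) k
      -- With this, the tail at `k + 1` after inserting `i` is the average of the old tails at `k +
      -- 1` and `k` with weights `1 - p i` and `p i`.
      have e : ∀ q : ι → ℝ, (bernoulliGen s q).coeff k = lowerTail s q (k + 1) - lowerTail s q k := by
        intro q; simp [lowerTail, Finset.sum_range_succ]
      rw [lowerTail_insert_succ hi, lowerTail_insert_succ hi]
      have h4 := mul_le_mul_of_nonneg_right (hpp i hii) h3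
      rw [e p, e p'] at *
      nlinarith [mul_le_mul_of_nonneg_left h1 (hp i hii), mul_le_mul_of_nonneg_left h2
        (sub_nonneg.2 ((hpp i hii).trans (hp' i hii)))]

end PoissonBinomial

/-! ### Numerical bounds for binomial lower tails. -/

lemma lowerTail_const {ι : Type*} (s : Finset ι) (q : ℝ) (k : ℕ) :
    lowerTail s (fun _ => q) k = ∑ l ∈ Finset.range k,
      (s.card.choose l : ℝ) * q ^ l * (1 - q) ^ (s.card - l) := by
  refine Finset.sum_congr rfl fun l _ => ?_
  rw [bernoulliGen, Finset.prod_const, add_comm, add_pow, finsetSum_coeff]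
  have : ∀ m, ((C q * X) ^ m * C (1 - q) ^ (s.card - m) * ((s.card.choose m : ℕ) : ℝ[X])).coeff l =
      if l = m then (s.card.choose l : ℝ) * q ^ l * (1 - q) ^ (s.card - l) else 0 := by
    intro m
    rw [mul_pow, ← C_pow, ← C_pow, ← C_eq_natCast,
      show C (q ^ m) * X ^ m * C ((1 - q) ^ (s.card - m)) * C ((s.card.choose m : ℕ) : ℝ) =
        C (q ^ m * (1 - q) ^ (s.card - m) * (s.card.choose m : ℝ)) * X ^ m by
          simp only [C_mul]; ring, coeff_C_mul_X_pow]
    split_ifs with h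
    · subst h; ring
    · rfl
  simp only [this]
  rw [Finset.sum_ite_eq]
  split_ifs with h
  · rfl
  · rw [Nat.choose_eq_zero_of_lt (by simpa using h)]; simp

/-- Chernoff's method with base 3: the weight `3 ^ (k - l)` is at least 1 for `l ≤ k`, and the
weighted sum over all `l` is a binomial expansion. -/
lemma binomial_lowerTail_le {n k : ℕ} (hkn : k ≤ n) {q : ℝ} (h0 : 0 ≤ q) (h1 : q ≤ 1) :
    ∑ l ∈ Finset.range (k + 1), (n.choose l : ℝ) * q ^ l * (1 - q) ^ (n - l) ≤
      3 ^ k * (1 - 2 * q / 3) ^ n := by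
  have h1' : 0 ≤ 1 - q := by linarith
  have e : (1 - 2 * q / 3) ^ n =
      ∑ l ∈ Finset.range (n + 1), (q / 3) ^ l * (1 - q) ^ (n - l) * (n.choose l : ℝ) := by
    rw [← add_pow]; congr 1; ring
  rw [e, Finset.mul_sum]
  refine (Finset.sum_le_sum (g := fun l => 3 ^ k * ((q / 3) ^ l * (1 - q) ^ (n - l) *
    (n.choose l : ℝ))) fun l hl => ?_).trans
    (Finset.sum_le_sum_of_subset_of_nonneg (Finset.range_mono (by omega)) fun l _ _ => by positivity)
  have hl' : l ≤ k := by simpa [Nat.lt_succ_iff] using hl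
  obtain ⟨m, rfl⟩ := Nat.exists_eq_add_of_le hl'
  have : (3 : ℝ) ^ (l + m) * ((q / 3) ^ l * (1 - q) ^ (n - l) * (n.choose l : ℝ)) =
      3 ^ m * ((n.choose l : ℝ) * q ^ l * (1 - q) ^ (n - l)) := by
    rw [div_pow, pow_add]; field_simp
  rw [this]
  exact le_mul_of_one_le_left (by positivity) (one_le_pow₀ (by norm_num))

/-- Passing from `n` to `n + 4` multiplies the exponential part by `3 * (2/3)^4 = 16/27`, which
beats the linear factor; four consecutive base cases suffice. -/
lemma geometric_bound (n : ℕ) (hn : 39 ≤ n) :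
    2 * ((n : ℝ) + 1) * (3 ^ ((n - 1) / 4) * ((2 / 3) ^ n * 3)) < 1 := by
  induction n using Nat.strong_induction_on with
  | _ n ih =>
  by_cases h : n < 43
  · interval_cases n <;> norm_num
  · obtain ⟨m, rfl⟩ : ∃ m, n = m + 4 := ⟨n - 4, by omega⟩
    have := ih m (by omega) (by omega)
    have hm : (39 : ℝ) ≤ m := by exact_mod_cast (by omega : 39 ≤ m)
    rw [show (m + 4 - 1) / 4 = (m - 1) / 4 + 1 by omega, pow_succ, pow_add]
    push_cast
    set A : ℝ := 3 ^ ((m - 1) / 4) * ((2 / 3) ^ m * 3) with hA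
    have hA0 : 0 < A := by positivity
    have : 2 * ((m : ℝ) + 4 + 1) * (3 ^ ((m - 1) / 4) * 3 * ((2 / 3) ^ m * (2 / 3) ^ 4 * 3)) =
        2 * ((m : ℝ) + 5) * (48 / 81) * A := by rw [hA]; ring
    rw [this]
    nlinarith

lemma binomial_lowerTail_lt_of_large {n : ℕ} (hn : 39 ≤ n) {q : ℝ}
    (hq : q = 1 / 2 - 3 / (4 * n)) :
    2 * ((n : ℝ) + 1) * ∑ l ∈ Finset.range ((n - 1) / 4 + 1),
      (n.choose l : ℝ) * q ^ l * (1 - q) ^ (n - l) < 1 := by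
  have hn' : (39 : ℝ) ≤ n := by exact_mod_cast hn
  have hpos : (0 : ℝ) < n := by linarith
  have hs : 3 / (4 * (n : ℝ)) ≤ 1 / 2 := by
    rw [div_le_div_iff₀ (by positivity) (by norm_num)]; linarith
  have hs0 : 0 ≤ 3 / (4 * (n : ℝ)) := by positivity
  refine lt_of_le_of_lt (mul_le_mul_of_nonneg_left (binomial_lowerTail_le (by omega)
    (by linarith) (by linarith)) (by positivity)) ?_
  refine lt_of_le_of_lt ?_ (geometric_bound n hn)
  gcongr
  have e : 1 - 2 * q / 3 = 2 / 3 * (1 + 3 / (4 * n)) := by rw [hq]; ring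
  rw [e, mul_pow]
  gcongr
  calc (1 + 3 / (4 * (n : ℝ))) ^ n ≤ (Real.exp (3 / (4 * n))) ^ n := by
        gcongr; rw [add_comm]; exact Real.add_one_le_exp _
    _ = Real.exp (3 / 4) := by rw [← Real.exp_nat_mul]; congr 1; field_simp
    _ ≤ Real.exp 1 := Real.exp_le_exp.2 (by norm_num)
    _ ≤ 3 := by linarith [Real.exp_one_lt_d9]

/-- Multiplying by `(4n)^n` clears the denominators of `q` and `1 - q`, leaving a decidable
inequality of naturals. -/
lemma binomial_lowerTail_lt_of_nat {n k j : ℕ} (hn : 0 < n) (hj : j ≤ 2 * n) (hk : k ≤ n)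
    (h : 2 * (n + 1) * ∑ l ∈ Finset.range (k + 1),
      n.choose l * (2 * n - j) ^ l * (2 * n + j) ^ (n - l) < (4 * n) ^ n) {q : ℝ}
    (hq : q = 1 / 2 - j / (4 * n)) :
    2 * ((n : ℝ) + 1) * ∑ l ∈ Finset.range (k + 1),
      (n.choose l : ℝ) * q ^ l * (1 - q) ^ (n - l) < 1 := by
  have hn' : (0 : ℝ) < n := by exact_mod_cast hn
  have h' : (2 * ((n : ℝ) + 1) * ∑ l ∈ Finset.range (k + 1),
      (n.choose l : ℝ) * (2 * n - j) ^ l * (2 * n + j) ^ (n - l)) < (4 * n) ^ n := by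
    have := (Nat.cast_lt (α := ℝ)).2 h
    push_cast [Nat.cast_sub hj] at this
    exact this
  have hp : (0 : ℝ) < (4 * n) ^ n := by positivity
  refine lt_of_mul_lt_mul_right ?_ hp.le
  rw [one_mul]
  refine lt_of_eq_of_lt ?_ h'
  rw [mul_assoc, Finset.sum_mul]
  congr 1
  refine Finset.sum_congr rfl fun l hl => ?_
  have hl' : l ≤ n := by have := Finset.mem_range.1 hl; omega
  have e1 : (2 * n - j : ℝ) = 4 * n * q := by rw [hq]; field_simp; ring
  have e2 : (2 * n + j : ℝ) = 4 * n * (1 - q) := by rw [hq]; field_simp; ring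
  have e3 : ((4 : ℝ) * n) ^ n = (4 * n) ^ l * (4 * n) ^ (n - l) := by
    rw [← pow_add]; congr 1; omega
  rw [e1, e2, e3, mul_pow _ q, mul_pow _ (1 - q)]
  ring

/-- Here `n = c - 1`. Exclusions are genuine: at `n = 13` even `q = 1/2` gives `28 * 378 / 8192 >
1`. -/
lemma nat_tail_of_irreg_half {n : ℕ} (h1 : 12 ≤ n) (h2 : n < 39) (h3 : n ≠ 13) (h4 : n ≠ 14)
    (h5 : n ≠ 17) :
    2 * (n + 1) * ∑ l ∈ Finset.range ((n - 1) / 4 + 1),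
      n.choose l * (2 * n - 1) ^ l * (2 * n + 1) ^ (n - l) < (4 * n) ^ n := by
  interval_cases n <;> first
    | contradiction
    | (simp only [Nat.reduceSub, Nat.reduceDiv, Nat.reduceAdd, Finset.sum_range_succ,
        Finset.sum_range_zero]; norm_num [Nat.choose_eq_descFactorial_div_factorial, Nat.descFactorial,
        Nat.factorial])

lemma nat_tail_of_irreg_one {n : ℕ} (h1 : 16 ≤ n) (h2 : n < 39) (h3 : n ≠ 17) (h4 : n ≠ 18)
    (h5 : n ≠ 21) :
    2 * (n + 1) * ∑ l ∈ Finset.range ((n - 1) / 4 + 1),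
      n.choose l * (2 * n - 2) ^ l * (2 * n + 2) ^ (n - l) < (4 * n) ^ n := by
  interval_cases n <;> first
    | contradiction
    | (simp only [Nat.reduceSub, Nat.reduceDiv, Nat.reduceAdd, Finset.sum_range_succ,
        Finset.sum_range_zero]; norm_num [Nat.choose_eq_descFactorial_div_factorial, Nat.descFactorial,
        Nat.factorial])

lemma nat_tail_of_irreg_three_halves {n : ℕ} (h1 : 20 ≤ n) (h2 : n < 39) (h3 : n ≠ 21)
    (h4 : n ≠ 22) (h5 : n ≠ 25) :
    2 * (n + 1) * ∑ l ∈ Finset.range ((n - 1) / 4 + 1),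
      n.choose l * (2 * n - 3) ^ l * (2 * n + 3) ^ (n - l) < (4 * n) ^ n := by
  interval_cases n <;> first
    | contradiction
    | (simp only [Nat.reduceSub, Nat.reduceDiv, Nat.reduceAdd, Finset.sum_range_succ,
        Finset.sum_range_zero]; norm_num [Nat.choose_eq_descFactorial_div_factorial, Nat.descFactorial,
        Nat.factorial])

/-! ### Degrees and strong connectivity in tournaments. -/

open Classical in
lemma outDeg_eq_card {W : Type*} [Fintype W] (D : Digraph W) (x : W) :
    outDeg D x = (Finset.univ.filter fun y => D.Adj x y).card := by
  rw [outDeg, Set.ncard_eq_toFinset_card']; simp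

open Classical in
lemma inDeg_eq_card {W : Type*} [Fintype W] (D : Digraph W) (x : W) :
    inDeg D x = (Finset.univ.filter fun y => D.Adj y x).card := by
  rw [inDeg, Set.ncard_eq_toFinset_card']; simp

lemma minDeg_le {W : Type*} (D : Digraph W) (x : W) :
    minDeg D ≤ min (outDeg D x) (inDeg D x) :=
  ciInf_le (OrderBot.bddBelow _) x

open Classical in
/-- The out-degrees inside a set of `m` vertices of a tournament add up to `m (m - 1) / 2`. -/
lemma IsTournament.two_mul_sum_card {W : Type*} {D : Digraph W} (hD : IsTournament D)
    (R : Finset W) :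
    2 * ∑ x ∈ R, (R.filter fun y => D.Adj x y).card = R.card * (R.card - 1) := by
  have hswap : ∑ x ∈ R, (R.filter fun y => D.Adj x y).card =
      ∑ x ∈ R, (R.filter fun y => D.Adj y x).card := by
    simp only [Finset.card_filter]
    exact Finset.sum_comm
  have hsum : ∀ x ∈ R, (R.filter fun y => D.Adj x y).card + (R.filter fun y => D.Adj y x).card =
      R.card - 1 := by
    intro x hx
    rw [← Finset.card_erase_of_mem hx, ← Finset.card_union_of_disjoint]
    · congr 1
      ext y
      simp only [Finset.mem_union, Finset.mem_filter, Finset.mem_erase]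
      by_cases hxy : y = x
      · subst hxy; simp [hD.loopless]
      · have := hD.xor_adj x y (Ne.symm hxy)
        simp only [Xor] at this
        tauto
    · rw [Finset.disjoint_left]
      intro y h1 h2
      have a := (Finset.mem_filter.1 h1).2
      have b := (Finset.mem_filter.1 h2).2
      by_cases hxy : x = y
      · subst hxy; exact hD.loopless _ a
      · have := hD.xor_adj x y hxy
        simp only [Xor] at this
        tauto
  rw [two_mul]
  nth_rewrite 2 [hswap]
  rw [← Finset.sum_add_distrib, Finset.sum_congr rfl hsum, Finset.sum_const, smul_eq_mul]

-- The average out-degree inside `R` is `(|R| - 1)/2`.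
open Classical in
lemma IsTournament.card_ge_of_outDeg {W : Type*} {D : Digraph W} (hD : IsTournament D)
    {R : Finset W} (hR : R.Nonempty) {d : ℕ}
    (hd : ∀ x ∈ R, d ≤ (R.filter fun y => D.Adj x y).card) : 2 * d + 1 ≤ R.card := by
  have h := hD.two_mul_sum_card R
  have h2 : R.card * d ≤ ∑ x ∈ R, (R.filter fun y => D.Adj x y).card := by
    simpa using Finset.card_nsmul_le_sum R _ d hd
  have hpos := hR.card_pos
  have h3 : R.card * (2 * d) ≤ R.card * (R.card - 1) := by rw [← h]; linarith
  have := Nat.le_of_mul_le_mul_left h3 hpos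
  omega

/-- The reverse of a digraph. -/
def rev {W : Type*} (D : Digraph W) : Digraph W where
  Adj x y := D.Adj y x

lemma IsTournament.rev {W : Type*} {D : Digraph W} (hD : IsTournament D) :
    IsTournament (rev D) where
  loopless := hD.loopless
  xor_adj x y h := hD.xor_adj y x h.symm

/-- A tournament with fewer than `4 d + 2` vertices and minimum degree at least `d` is strong. -/
lemma IsTournament.isStrong {W : Type*} [Finite W] {D : Digraph W} (hD : IsTournament D) {d : ℕ}
    (hd : d ≤ minDeg D) (hcard : Nat.card W < 4 * d + 2) : IsStrong D := by
  classical
  have := Fintype.ofFinite W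
  rw [Nat.card_eq_fintype_card] at hcard
  intro x y
  by_contra hxy
  -- `R` is closed under out-neighbours and its complement under in-neighbours, so each keeps degree
  -- `d` inside and has at least `2 * d + 1` vertices.
  let R : Finset W := Finset.univ.filter fun z => Relation.ReflTransGen D.Adj x z
  have hRmem : ∀ z, z ∈ R ↔ Relation.ReflTransGen D.Adj x z := by simp [R]
  have h1 : 2 * d + 1 ≤ R.card := by
    refine hD.card_ge_of_outDeg ⟨x, (hRmem x).2 .refl⟩ fun z hz => ?_
    refine (hd.trans (minDeg_le D z)).trans ((min_le_left _ _).trans ?_)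
    rw [outDeg_eq_card]
    refine Finset.card_le_card fun w hw => ?_
    have hw := (Finset.mem_filter.1 hw).2
    exact Finset.mem_filter.2 ⟨(hRmem w).2 (((hRmem z).1 hz).tail hw), hw⟩
  have h2 : 2 * d + 1 ≤ Rᶜ.card := by
    refine hD.rev.card_ge_of_outDeg ⟨y, by rw [Finset.mem_compl, hRmem]; exact hxy⟩ fun z hz => ?_
    refine (hd.trans (minDeg_le D z)).trans ((min_le_right _ _).trans ?_)
    rw [inDeg_eq_card]
    refine Finset.card_le_card fun w hw => ?_
    have hw := (Finset.mem_filter.1 hw).2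
    refine Finset.mem_filter.2 ⟨Finset.mem_compl.2 fun h => ?_, hw⟩
    exact Finset.mem_compl.1 hz ((hRmem z).2 (((hRmem w).1 h).tail hw))
  have := Finset.card_add_card_compl R
  omega

/-! ### Counting transversals and the union bound. -/

open Classical in
/-- The number of transversals through `x` with fewer than `k` entries satisfying `R`. -/
lemma card_transversals {ι V : Type*} [Fintype ι] {A : ι → Finset V} {r : ℕ} (hr : 0 < r)
    (hA : ∀ i, (A i).card = r) (R : V → Prop) {i : ι} {x : V} (hx : x ∈ A i) (hR : ¬ R x) (k : ℕ) :
    (((Fintype.piFinset A).filter fun f =>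
        f i = x ∧ (Finset.univ.filter fun j => R (f j)).card < k).card : ℝ) =
      r ^ (Fintype.card ι - 1) * lowerTail (Finset.univ.erase i)
        (fun j => ((A j).filter R).card / r) k := by
  have hr' : (r : ℝ) ≠ 0 := by exact_mod_cast hr.ne'
  set A' : ι → Finset V := Function.update A i {x} with hA'
  have hAi : A' i = {x} := by simp [hA']
  have hAj : ∀ j, j ≠ i → A' j = A j := fun j hj => by simp [hA', hj]
  have hfilter : (Fintype.piFinset A).filter (fun f =>
        f i = x ∧ (Finset.univ.filter fun j => R (f j)).card < k) =
      (Fintype.piFinset A').filter fun f =>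
        (Finset.univ.filter fun j => R (f j)).card < k := by
    ext f
    simp only [Finset.mem_filter, Fintype.mem_piFinset]
    constructor
    · rintro ⟨h1, h2, h3⟩
      refine ⟨fun j => ?_, h3⟩
      by_cases hj : j = i
      · subst hj; simp [hAi, h2]
      · rw [hAj j hj]; exact h1 j
    · rintro ⟨h1, h3⟩
      have h2 : f i = x := by simpa [hAi] using h1 i
      refine ⟨fun j => ?_, h2, h3⟩
      by_cases hj : j = i
      · subst hj; rwa [h2]
      · rw [← hAj j hj]; exact h1 j
  -- The generating function factors over the coordinates; coordinate `i` contributes 1 because `R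
  -- x` fails.
  have hgen : ∑ f ∈ Fintype.piFinset A', (X : ℝ[X]) ^ (Finset.univ.filter fun j => R (f j)).card =
      C ((r : ℝ) ^ (Fintype.card ι - 1)) * bernoulliGen (Finset.univ.erase i)
        (fun j => ((A j).filter R).card / r) := by
    have h1 : ∀ f : ι → V, (X : ℝ[X]) ^ (Finset.univ.filter fun j => R (f j)).card =
        ∏ j, X ^ (if R (f j) then 1 else 0) := by
      intro f; rw [Finset.prod_pow_eq_pow_sum, Finset.card_filter]
    simp only [h1]
    rw [← Finset.prod_univ_sum A' fun (_ : ι) a => (X : ℝ[X]) ^ (if R a then 1 else 0),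
      ← Finset.mul_prod_erase _ _ (Finset.mem_univ i), hAi, bernoulliGen, C_pow,
      show Fintype.card ι - 1 = (Finset.univ.erase i).card by
        rw [Finset.card_erase_of_mem (Finset.mem_univ i), Finset.card_univ],
      ← Finset.prod_const, ← Finset.prod_mul_distrib]
    simp only [Finset.sum_singleton, if_neg hR, pow_zero, one_mul]
    refine Finset.prod_congr rfl fun j hj => ?_
    rw [hAj j (Finset.ne_of_mem_erase hj)]
    have hsplit := Finset.card_filter_add_card_filter_not (s := A j) R
    rw [hA j] at hsplit
    have hc : (((A j).filter fun a => ¬ R a).card : ℝ) = r - ((A j).filter R).card := by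
      rw [← hsplit]; push_cast; ring
    have h2 : ∑ a ∈ A j, (X : ℝ[X]) ^ (if R a then 1 else 0) =
        C (((A j).filter fun a => ¬ R a).card : ℝ) + C (((A j).filter R).card : ℝ) * X := by
      rw [← Finset.sum_filter_add_sum_filter_not (A j) R, add_comm]
      congr 1
      · rw [Finset.sum_congr rfl (g := fun _ => 1)]
        · simp
        · intro a ha; simp [(Finset.mem_filter.1 ha).2]
      · rw [Finset.sum_congr rfl (g := fun _ => X)]
        · simp
        · intro a ha; simp [(Finset.mem_filter.1 ha).2]
    rw [h2, hc, mul_add, ← mul_assoc, ← C_mul, ← C_mul]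
    congr 3 <;> field_simp
  rw [hfilter, lowerTail, Finset.mul_sum]
  simp only [← coeff_C_mul, ← hgen, finsetSum_coeff, coeff_X_pow]
  rw [Finset.sum_comm, Finset.card_filter]
  push_cast
  refine Finset.sum_congr rfl fun f _ => ?_
  rw [Finset.sum_ite_eq']
  simp

open Classical in
/-- If every vertex has small enough lower tails in both relations, then some transversal has
all its degrees at least `k`. -/
lemma exists_transversal {ι V : Type*} [Fintype ι] [Nonempty ι] {A : ι → Finset V} {r : ℕ}
    (hr : 0 < r) (hA : ∀ i, (A i).card = r) (R : Bool → V → V → Prop) (hR : ∀ b x, ¬ R b x x)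
    (k : ℕ) (htail : ∀ i, ∀ x ∈ A i, ∀ b, 2 * (Fintype.card ι : ℝ) *
      lowerTail (Finset.univ.erase i) (fun j => ((A j).filter (R b x)).card / r) k < 1) :
    ∃ f : ι → V, (∀ i, f i ∈ A i) ∧
      ∀ i b, k ≤ (Finset.univ.filter fun j => R b (f i) (f j)).card := by
  by_contra hcon
  push Not at hcon
  set N := Fintype.card ι with hN
  have hNpos : 0 < N := Fintype.card_pos
  have hN' : (0 : ℝ) < N := by exact_mod_cast hNpos
  have hr' : (0 : ℝ) < r := by exact_mod_cast hr
  let B : ι → V → Bool → Finset (ι → V) := fun i x b => (Fintype.piFinset A).filter fun f =>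
    f i = x ∧ (Finset.univ.filter fun j => R b x (f j)).card < k
  have hcover : Fintype.piFinset A ⊆ Finset.univ.biUnion fun i => (A i).biUnion fun x =>
      Finset.univ.biUnion fun b => B i x b := by
    intro f hf
    obtain ⟨i, b, hib⟩ := hcon f (Fintype.mem_piFinset.1 hf)
    simp only [Finset.mem_biUnion, Finset.mem_univ, true_and]
    exact ⟨i, f i, Fintype.mem_piFinset.1 hf i, b, Finset.mem_filter.2 ⟨hf, rfl, hib⟩⟩
  have hcard : (Fintype.piFinset A).card ≤ ∑ i, ∑ x ∈ A i, ∑ b, (B i x b).card :=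
    (Finset.card_le_card hcover).trans <| Finset.card_biUnion_le.trans <|
      Finset.sum_le_sum fun i _ => Finset.card_biUnion_le.trans <|
        Finset.sum_le_sum fun x _ => Finset.card_biUnion_le
  -- There are `2Nr` triples `(i, x, b)` and `r ^ N` transversals, hence this share for each.
  have hlt : ∀ i, ∀ x ∈ A i, ∀ b, ((B i x b).card : ℝ) < r ^ (N - 1) / (2 * N) := by
    intro i x hx b
    rw [show ((B i x b).card : ℝ) = _ from card_transversals hr hA (R b x) hx (hR b x) k,
      lt_div_iff₀ (by positivity)]
    have := mul_lt_mul_of_pos_left (htail i x hx b) (pow_pos hr' (N - 1))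
    linarith
  have hsum : ∑ i, ∑ x ∈ A i, ∑ b, ((B i x b).card : ℝ) <
      ∑ i, ∑ x ∈ A i, ∑ _b : Bool, (r : ℝ) ^ (N - 1) / (2 * N) := by
    refine Finset.sum_lt_sum_of_nonempty Finset.univ_nonempty fun i _ =>
      Finset.sum_lt_sum_of_nonempty (Finset.card_pos.1 (by rw [hA i]; exact hr)) fun x hx =>
        Finset.sum_lt_sum_of_nonempty Finset.univ_nonempty fun b _ => hlt i x hx b
  have htotal : ∑ i, ∑ x ∈ A i, ∑ _b : Bool, (r : ℝ) ^ (N - 1) / (2 * N) = r ^ N := by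
    simp only [Finset.sum_const, hA, Finset.card_univ, Fintype.card_bool, nsmul_eq_mul, ← hN]
    rw [show (r : ℝ) ^ N = r * r ^ (N - 1) by rw [← pow_succ']; congr 1; omega]
    push_cast
    field_simp
  rw [Fintype.card_piFinset, Finset.prod_congr rfl fun i _ => hA i, Finset.prod_const,
    Finset.card_univ, ← hN] at hcard
  have := (Nat.cast_le (α := ℝ)).2 hcard
  push_cast at this
  linarith

/-! ### Degrees in balanced partite tournaments. -/

section Degrees

variable {V : Type*} [Fintype V] {G : Digraph V} {r c : ℕ} {part : V → Fin c}

open Classical in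
lemma IsBalancedPartiteTournament.card_filter_part
    (hG : IsBalancedPartiteTournament G r c part) (i : Fin c) :
    (Finset.univ.filter fun x => part x = i).card = r := by
  rw [← hG.card_part i, Set.ncard_eq_toFinset_card']; simp

open Classical in
lemma sum_card_filter_part (R : V → Prop) {i : Fin c} (hR : ∀ y, part y = i → ¬ R y) :
    ∑ j ∈ Finset.univ.erase i,
      ((Finset.univ.filter fun x => part x = j).filter R).card =
      (Finset.univ.filter R).card := by
  rw [Finset.card_eq_sum_card_fiberwise (f := part) (t := Finset.univ.erase i)]
  · refine Finset.sum_congr rfl fun j _ => ?_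
    rw [Finset.filter_comm]
  · intro y hy
    refine Finset.mem_coe.2 (Finset.mem_erase.2 ⟨fun h => hR y h ?_, Finset.mem_univ _⟩)
    simpa using hy

lemma IsBalancedPartiteTournament.outDeg_add_inDeg
    (hG : IsBalancedPartiteTournament G r c part) (x : V) :
    outDeg G x + inDeg G x + r = r * c := by
  classical
  have htot : Fintype.card V = r * c := by
    rw [← Finset.card_univ, Finset.card_eq_sum_card_fiberwise (f := part) (t := Finset.univ)
      (fun _ _ => by simp), Finset.sum_congr rfl fun i _ => hG.card_filter_part i]
    simp [mul_comm]
  rw [outDeg_eq_card, inDeg_eq_card, ← hG.card_filter_part (part x), ← Finset.card_union_of_disjoint,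
    ← Finset.card_union_of_disjoint, hG.card_filter_part, ← htot, ← Finset.card_univ]
  · congr 1
    ext y
    simp only [Finset.mem_union, Finset.mem_filter, Finset.mem_univ, true_and, iff_true]
    by_cases h : part y = part x
    · exact Or.inr h
    · rcases hG.xor_adj x y (Ne.symm h) with h' | h'
      · exact Or.inl (Or.inl h'.1)
      · exact Or.inl (Or.inr h'.1)
  · rw [Finset.disjoint_left]
    intro y h1 h2
    have h2 := (Finset.mem_filter.1 h2).2
    rcases Finset.mem_union.1 h1 with h | h
    · exact hG.not_adj_of_same_part x y h2.symm (Finset.mem_filter.1 h).2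
    · exact hG.not_adj_of_same_part y x h2 (Finset.mem_filter.1 h).2
  · rw [Finset.disjoint_left]
    intro y h1 h2
    have h1 := (Finset.mem_filter.1 h1).2
    have h2 := (Finset.mem_filter.1 h2).2
    by_cases h : part x = part y
    · exact hG.not_adj_of_same_part x y h h1
    · rcases hG.xor_adj x y h with h' | h'
      · exact h'.2 h2
      · exact h'.2 h1

lemma max_sub_min_le_globalIrreg (G : Digraph V) (x : V) :
    ((max (outDeg G x) (inDeg G x) : ℕ) : ℤ) - ((min (outDeg G x) (inDeg G x) : ℕ) : ℤ) ≤
      globalIrreg G :=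
  le_ciSup (f := fun p : V × V => ((max (outDeg G p.1) (inDeg G p.1) : ℕ) : ℤ) -
    ((min (outDeg G p.2) (inDeg G p.2) : ℕ) : ℤ)) (Set.finite_range _).bddAbove (x, x)

lemma abs_sub_le_globalIrreg (G : Digraph V) (x : V) :
    |(outDeg G x : ℤ) - inDeg G x| ≤ globalIrreg G := by
  have := max_sub_min_le_globalIrreg G x
  rw [abs_le]
  omega

end Degrees

/-! ### Assembling the bounds. -/

/-- A vertex of nearly balanced degree has a small lower tail as soon as the corresponding binomial
distribution has. -/
lemma lowerTail_lt {ι : Type*} [DecidableEq ι] {s : Finset ι} {p : ι → ℝ} {k j : ℕ}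
    (hp : ∀ i ∈ s, 0 ≤ p i ∧ p i ≤ 1) (hs : 0 < s.card)
    (hmean : (s.card : ℝ) / 2 - j / 4 ≤ ∑ i ∈ s, p i)
    (hk : (k : ℝ) + 2 ≤ (s.card : ℝ) / 2 - j / 4)
    (hbin : ∀ q : ℝ, q = 1 / 2 - j / (4 * s.card) →
      2 * ((s.card : ℝ) + 1) * ∑ l ∈ Finset.range (k + 1),
        (s.card.choose l : ℝ) * q ^ l * (1 - q) ^ (s.card - l) < 1) :
    2 * ((s.card : ℝ) + 1) * lowerTail s p (k + 1) < 1 := by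
  have hs' : (0 : ℝ) < s.card := by exact_mod_cast hs
  set m := ∑ i ∈ s, p i with hm
  have hle : m ≤ s.card := by
    simpa using Finset.sum_le_sum fun i hi => (hp i hi).2
  refine lt_of_le_of_lt (mul_le_mul_of_nonneg_left ?_ (by positivity)) (hbin _ rfl)
  rw [← lowerTail_const]
  -- Equalise the parameters at the true mean first, then lower the common value to `1/2 - j/(4 *
  -- s.card)`.
  refine (lowerTail_le_const hp (hk.trans hmean) (q := m / s.card) (by rw [← hm]; field_simp)).trans
    (lowerTail_anti ?_ ?_ ?_ _)
  · intro _ _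
    have : (1 / 2 - j / (4 * s.card) : ℝ) = (s.card / 2 - j / 4) / s.card := by field_simp
    rw [this]
    exact div_nonneg (by linarith [Nat.cast_nonneg (α := ℝ) k]) hs'.le
  · intro _ _
    rw [le_div_iff₀ hs']
    refine le_trans (le_of_eq ?_) hmean
    field_simp
  · intro _ _
    rw [div_le_one hs']; exact hle

/-- The numerical part: the three ranges of the number of parts. -/
lemma exists_irreg_bound {c : ℕ} {r g : ℝ} (hr : 0 < r)
    (hcase : (g ≤ r / 2 ∧ 13 ≤ c ∧ c ≠ 14 ∧ c ≠ 15 ∧ c ≠ 18) ∨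
      (g ≤ r ∧ 17 ≤ c ∧ c ≠ 18 ∧ c ≠ 19 ∧ c ≠ 22) ∨
      (g ≤ 3 * r / 2 ∧ 21 ≤ c ∧ c ≠ 22 ∧ c ≠ 23 ∧ c ≠ 26)) :
    13 ≤ c ∧ ∃ j : ℕ, j ≤ 3 ∧ g ≤ j * r / 2 ∧ ∀ q : ℝ, q = 1 / 2 - j / (4 * (c - 1 : ℕ)) →
      2 * (((c - 1 : ℕ) : ℝ) + 1) * ∑ l ∈ Finset.range ((c - 2) / 4 + 1),
        ((c - 1).choose l : ℝ) * q ^ l * (1 - q) ^ (c - 1 - l) < 1 := by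
  have hc : 13 ≤ c := by omega
  obtain ⟨n, rfl⟩ : ∃ n, c = n + 1 := ⟨c - 1, by omega⟩
  simp only [Nat.add_sub_cancel, show (n + 1 - 2) / 4 = (n - 1) / 4 by omega]
  refine ⟨hc, ?_⟩
  by_cases hn : 39 ≤ n
  · refine ⟨3, le_rfl, ?_, fun q hq => binomial_lowerTail_lt_of_large hn (by simpa using hq)⟩
    push_cast
    rcases hcase with h | h | h <;> linarith [h.1]
  · rcases hcase with h | h | h
    · exact ⟨1, by norm_num, by push_cast; linarith [h.1], fun q hq =>
        binomial_lowerTail_lt_of_nat (by omega) (by omega) (by omega)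
          (nat_tail_of_irreg_half (by omega) (by omega) (by omega) (by omega) (by omega)) hq⟩
    · exact ⟨2, by norm_num, by push_cast; linarith [h.1], fun q hq =>
        binomial_lowerTail_lt_of_nat (by omega) (by omega) (by omega)
          (nat_tail_of_irreg_one (by omega) (by omega) (by omega) (by omega) (by omega)) hq⟩
    · exact ⟨3, by norm_num, by push_cast; linarith [h.1], fun q hq =>
        binomial_lowerTail_lt_of_nat (by omega) (by omega) (by omega)
          (nat_tail_of_irreg_three_halves (by omega) (by omega) (by omega) (by omega) (by omega))
          hq⟩

open Classical in
/-- The subtournament induced by a transversal inherits the degrees of the transversal. -/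
lemma IsBalancedPartiteTournament.exists_strong_of_transversal {V : Type*} [Fintype V]
    {G : Digraph V} {r c : ℕ} {part : V → Fin c} (hG : IsBalancedPartiteTournament G r c part)
    {f : Fin c → V} (hf : ∀ i, part (f i) = i) {d : ℕ} (hc : 0 < c) (hcd : c < 4 * d + 2)
    (hout : ∀ i, d ≤ (Finset.univ.filter fun j => G.Adj (f i) (f j)).card)
    (hin : ∀ i, d ≤ (Finset.univ.filter fun j => G.Adj (f j) (f i)).card) :
    ∃ S : Set V, S.ncard = c ∧ IsTournament (induced G S) ∧ IsStrong (induced G S) ∧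
      d ≤ minDeg (induced G S) := by
  have hinj : Function.Injective f := Function.LeftInverse.injective hf
  let F : Fin c → Set.range f := fun i => ⟨f i, i, rfl⟩
  have hFinj : Function.Injective F := fun i j h => hinj (congrArg Subtype.val h)
  have hcard : Nat.card (Set.range f) = c := by
    rw [Nat.card_range_of_injective hinj, Nat.card_fin]
  have hT : IsTournament (induced G (Set.range f)) := by
    refine ⟨fun x => hG.not_adj_of_same_part _ _ rfl, ?_⟩
    rintro ⟨_, i, rfl⟩ ⟨_, j, rfl⟩ h
    refine hG.xor_adj _ _ fun h' => h ?_
    rw [hf, hf] at h'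
    subst h'; rfl
  have hmin : d ≤ minDeg (induced G (Set.range f)) := by
    -- Needed because an infimum over an empty type in `ℕ` is 0.
    have : Nonempty (Set.range f) := ⟨F ⟨0, hc⟩⟩
    refine le_ciInf ?_
    rintro ⟨_, i, rfl⟩
    refine le_min ((hout i).trans ?_) ((hin i).trans ?_)
    · rw [outDeg_eq_card, ← Finset.card_map ⟨F, hFinj⟩]
      refine Finset.card_le_card fun y hy => ?_
      obtain ⟨j, hj, rfl⟩ := Finset.mem_map.1 hy
      exact Finset.mem_filter.2 ⟨Finset.mem_univ _, (Finset.mem_filter.1 hj).2⟩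
    · rw [inDeg_eq_card, ← Finset.card_map ⟨F, hFinj⟩]
      refine Finset.card_le_card fun y hy => ?_
      obtain ⟨j, hj, rfl⟩ := Finset.mem_map.1 hy
      exact Finset.mem_filter.2 ⟨Finset.mem_univ _, (Finset.mem_filter.1 hj).2⟩
  exact ⟨Set.range f, hcard, hT, hT.isStrong hmin (by rw [hcard]; exact hcd), hmin⟩

end PartiteTournament

open PartiteTournament in
theorem theorem4 {V : Type*} [Finite V] (r c : ℕ) (hr : 2 ≤ r)
    (G : Digraph V) (part : V → Fin c)
    (hG : PartiteTournament.IsBalancedPartiteTournament G r c part)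
    (hδ : (⌊((c : ℝ) - 2) / 4⌋ : ℝ) * ((r : ℝ) + (PartiteTournament.localIrreg G part : ℝ))
        * (((c : ℝ) - 1) / ((c : ℝ) - 2)) ≤ (PartiteTournament.minDeg G : ℝ))
    (hcase :
      ((PartiteTournament.globalIrreg G : ℝ) ≤ (r : ℝ) / 2 ∧
        13 ≤ c ∧ c ≠ 14 ∧ c ≠ 15 ∧ c ≠ 18) ∨
      ((PartiteTournament.globalIrreg G : ℝ) ≤ (r : ℝ) ∧
        17 ≤ c ∧ c ≠ 18 ∧ c ≠ 19 ∧ c ≠ 22) ∨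
      ((PartiteTournament.globalIrreg G : ℝ) ≤ 3 * (r : ℝ) / 2 ∧
        21 ≤ c ∧ c ≠ 22 ∧ c ≠ 23 ∧ c ≠ 26)) :
    ∃ S : Set V, S.ncard = c ∧
      PartiteTournament.IsTournament (PartiteTournament.induced G S) ∧
      PartiteTournament.IsStrong (PartiteTournament.induced G S) ∧
      ⌊((c : ℝ) - 2) / 4⌋ + 1 ≤ (PartiteTournament.minDeg (PartiteTournament.induced G S) : ℤ) := by
  classical
  have := Fintype.ofFinite V
  have hr0 : (0 : ℝ) < r := by exact_mod_cast (by omega : 0 < r)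
  obtain ⟨hc, j, hj, hg, hbin⟩ := exists_irreg_bound hr0 hcase
  have : Nonempty (Fin c) := ⟨⟨0, by omega⟩⟩
  have hfloor : ⌊((c : ℝ) - 2) / 4⌋ = (((c - 2) / 4 : ℕ) : ℤ) := by
    have h1 : 4 * ((c - 2) / 4) + 2 ≤ c := by omega
    have h2 : c < 4 * ((c - 2) / 4) + 6 := by omega
    have h1' : (4 * (((c - 2) / 4 : ℕ) : ℝ) + 2) ≤ c := by exact_mod_cast h1
    have h2' : (c : ℝ) < 4 * (((c - 2) / 4 : ℕ) : ℝ) + 6 := by exact_mod_cast h2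
    rw [Int.floor_eq_iff]
    constructor <;> rw [Int.cast_natCast] <;> linarith
  let R : Bool → V → V → Prop := fun b x y => bif b then G.Adj x y else G.Adj y x
  let A : Fin c → Finset V := fun i => Finset.univ.filter fun x => part x = i
  have hsame : ∀ b x y, part y = part x → ¬ R b x y := by
    rintro (_ | _) x y h
    · exact hG.not_adj_of_same_part y x h
    · exact hG.not_adj_of_same_part x y h.symm
  have hdeg : ∀ b x, (r : ℝ) * (((c - 1 : ℕ) : ℝ) / 2 - j / 4) ≤
      (Finset.univ.filter (R b x)).card := by
    intro b x
    have h1 : (outDeg G x : ℝ) + inDeg G x + r = r * c := by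
      exact_mod_cast hG.outDeg_add_inDeg x
    have h2 : |(outDeg G x : ℝ) - inDeg G x| ≤ globalIrreg G := by
      exact_mod_cast abs_sub_le_globalIrreg G x
    have h3 := abs_le.1 (h2.trans hg)
    rw [Nat.cast_sub (by omega)]
    push_cast
    cases b
    · rw [show (Finset.univ.filter (R false x)).card = inDeg G x from (inDeg_eq_card G x).symm]
      linarith
    · rw [show (Finset.univ.filter (R true x)).card = outDeg G x from (outDeg_eq_card G x).symm]
      linarith
  have hcard : ∀ i : Fin c, (Finset.univ.erase i).card = c - 1 := by
    intro i; rw [Finset.card_erase_of_mem (Finset.mem_univ i)]; simp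
  have hAcard : ∀ i, (A i).card = r := hG.card_filter_part
  obtain ⟨f, hfA, hf⟩ := exists_transversal (A := A) (by omega) hAcard R
    (fun b x => hsame b x x rfl) ((c - 2) / 4 + 1) (by
      intro i x hx b
      have hxi : part x = i := by simpa [A] using hx
      have key := lowerTail_lt (s := Finset.univ.erase i) (k := (c - 2) / 4) (j := j)
        (p := fun l => (((A l).filter (R b x)).card : ℝ) / r) (fun l _ => ⟨by positivity, by
          rw [div_le_one hr0, ← hAcard l]
          exact_mod_cast Finset.card_filter_le _ _⟩) (by rw [hcard]; omega) (by
          rw [hcard, ← Finset.sum_div, le_div_iff₀ hr0, ← Nat.cast_sum,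
            sum_card_filter_part (R b x) fun y hy => hsame b x y (hy.trans hxi.symm), mul_comm]
          exact hdeg b x) (by
          rw [hcard]
          have h1 : (((c - 2) / 4 : ℕ) : ℝ) ≤ ((c - 2 : ℕ) : ℝ) / 4 := Nat.cast_div_le
          rw [Nat.cast_sub (by omega)] at h1 ⊢
          have h2 : (j : ℝ) ≤ 3 := by exact_mod_cast hj
          have h3 : (13 : ℝ) ≤ c := by exact_mod_cast hc
          push_cast at h1 ⊢
          linarith) (by rw [hcard]; exact hbin)
      rw [hcard] at key
      rw [Fintype.card_fin]
      convert key using 3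
      · rw [Nat.cast_sub (by omega)]
        push_cast; ring
      · ext; simp)
  -- The last `omega` is `c < 4 * d + 2`, the strong connectivity threshold; it has no slack when `c
  -- % 4 = 1`.
  obtain ⟨S, h1, h2, h3, h4⟩ := hG.exists_strong_of_transversal (f := f) (d := (c - 2) / 4 + 1)
    (fun i => by simpa [A] using hfA i) (by omega) (by omega) (fun i => hf i true)
    (fun i => hf i false)
  refine ⟨S, h1, h2, h3, ?_⟩
  rw [hfloor]
  exact_mod_cast h4
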